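/- Let $\beta>1$ be a real number, let $I_\beta=\left[-\frac{\beta}{\beta+1},\frac{1}{\beta+1}\right)$, and let $T:I_\beta\to I_\beta$ be given by $T(x)=-\beta x-\left\lfloor -\beta x+\frac{\beta}{\beta+1}\right\rfloor$. For $x\in I_\beta$ let $d_{-\beta}(x)=x_1x_2x_3\cdots$ with $x_i=\left\lfloor -\beta T^{i-1}(x)+\frac{\beta}{\beta+1}\right\rfloor$ for $i\ge 1$. A string of integers is called $(-\beta)$-admissible if it equals $d_{-\beta}(x)$ for some $x\in I_\beta$. Let $\mathrm{Fin}(-\beta)$ be the set of real numbers with a finite $(-\beta)$-expansion, that is, the set consisting of $0$ and of all $x=\sum_{i\ge 1}x_i(-\beta)^{n-i+1}$ with $n\in\mathbb{Z}$, $x_1\neq 0$, the string $0x_1x_2x_3\cdots$ $(-\beta)$-admissible, and $x_i=0$ for all sufficiently large $i$. Suppose that $d_{-\beta}\left(-\frac{\beta}{\beta+1}\right)$ is eventually periodic and does not end in $0^\omega$, and that $\mathrm{Fin}(-\beta)=\mathbb{Z}[\beta]$. Then there exists a constant $\gamma>0$ such that every rational number $x\in(-\gamma,\gamma)$ lies in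 $I_\beta$ and has a purely periodic $(-\beta)$-expansion, i.e. $d_{-\beta}(x)=(a_1\cdots a_N)^\omega$ for some $N\ge 1$. -/

import Mathlib

open Filter

noncomputable section

namespace NegBase

/-- The left endpoint `-β/(β+1)` of the interval `I_β`. -/
def leftEnd (β : ℝ) : ℝ := -β / (β + 1)

/-- The half-open interval `I_β = [-β/(β+1), 1/(β+1))`. -/
def I (β : ℝ) : Set ℝ := Set.Ico (leftEnd β) (1 / (β + 1))

/-- The `(-β)`-transformation `T x = -β x - ⌊-β x + β/(β+1)⌋`, which maps `I_β` to itself. -/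
def T (β x : ℝ) : ℝ := -β * x - (⌊-β * x + β / (β + 1)⌋ : ℝ)

/-- The digit string `d_{-β}(x)` of `x ∈ I_β`, indexed from `0`:
its entry at `i` is `⌊-β T^i(x) + β/(β+1)⌋`. -/
def digits (β x : ℝ) (i : ℕ) : ℤ := ⌊-β * ((T β)^[i] x) + β / (β + 1)⌋

/-- A string is `(-β)`-admissible if it is `d_{-β}(x)` for some `x ∈ I_β`. -/
def Admissible (β : ℝ) (s : ℕ → ℤ) : Prop := ∃ x ∈ I β, digits β x = s

/-- The string `0 s₀ s₁ s₂ …`. -/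
def consZero (s : ℕ → ℤ) : ℕ → ℤ
  | 0 => 0
  | i + 1 => s i

/-- The string ends in `0^ω`. -/
def EndsInZeros (s : ℕ → ℤ) : Prop := ∀ᶠ i in atTop, s i = 0

/-- The string is eventually periodic. -/
def EventuallyPeriodic (s : ℕ → ℤ) : Prop := ∃ p : ℕ, 0 < p ∧ ∀ᶠ i in atTop, s (i + p) = s i

/-- The string is purely periodic. -/
def PurelyPeriodic (s : ℕ → ℤ) : Prop := ∃ p : ℕ, 0 < p ∧ ∀ i, s (i + p) = s i

/-- `s₀ s₁ s₂ …`, with leading position `n`, is the `(-β)`-expansion of the (nonzero) real number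
`x`: `x = ∑ sᵢ (-β)^(n-i)`, where `s₀ ≠ 0` and `0 s₀ s₁ s₂ …` is admissible. -/
def IsExpansion (β x : ℝ) (n : ℤ) (s : ℕ → ℤ) : Prop :=
  s 0 ≠ 0 ∧ Admissible β (consZero s) ∧ HasSum (fun i : ℕ => (s i : ℝ) * (-β) ^ (n - (i : ℤ))) x

/-- `Fin(-β)`: the real numbers with a finite `(-β)`-expansion. The number `0`, whose expansion
is `0^ω` and so has no leading nonzero digit, is listed separately. -/
def finiteExpansions (β : ℝ) : Set ℝ :=
  {x | x = 0 ∨ ∃ (n : ℤ) (s : ℕ → ℤ), IsExpansion β x n s ∧ EndsInZeros s}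

end NegBase

end

/-!
Let `I` be the interval `I_β` and call a point of `I` finite if some iterate of `T` carries it to
`0`. Since `leftEnd β` is not finite, `Fin(-β) = ℤ[β]` says that every point of `I ∩ ℤ[β]` is finite
(`exists_iterate_eq_zero`); it also makes `β` an algebraic integer with `β⁻¹ ∈ ℤ[β]`.

All other conjugates `γ` of `β` satisfy `|γ| < 1` (`norm_conjugate_lt_one`). To see this, take the
finite points `f = (-β)^(L+1) - n` with `n ∈ ℤ` and apply the conjugation to their expansions. If
`|γ| > 1`, the conjugate of `f` is bounded independently of `L`, and so is `γ^(L+1) - β^(L+1)`, which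
forces `γ = β`. If `|γ| = 1`, complex conjugation shows that `β⁻¹` is a conjugate of `β` as well. The
conjugation `β ↦ β⁻¹` turns the expansion `∑ dᵢ (-β)^(-i)` of `f` into `∑ dᵢ (-β)^i`, whose last
nonzero digit dominates (`exists_le_neg_shiftIter`); so the length of the expansion is at most
`L + O(1)`. But at `γ` an expansion of length `k` has absolute value `O(k)`, while the conjugate of `f`
there is of size `β^L`.

Now let `x` be a rational number close to `0`. As `-β` is a unit of `ℤ[β]`, there are large `N` with
`w = x ((-β)^N - 1) ∈ ℤ[β]`. The other conjugates of `w` are at most `2 |x|` in absolute value. For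
fixed `k` and small `x` those of `(-β)^(-k) w` are bounded by `1`, hence the conjugates of the point
`T^(N-k) (w / (-β)^N)` are bounded by a constant. There are only finitely many such points in
`I ∩ ℤ[β]`, so with a suitable `k` all of them are carried to `0` by `T^k`. Thus
`T^N (x - x / (-β)^N) = 0` (`exists_iterate_sub_div_eq_zero`).

Finally, the orbit of `leftEnd β` is finite and avoids `0`, so a point carried to `0` by `T^j` keeps a
distance of order `β^(-j)` from the end points of `I` (`exists_gap`). Adding `x / (-β)^N` to
`x - x / (-β)^N` therefore does not change the first `N` digits, and `T^N x = x`.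
-/

namespace NegBase

/-! ### The transformation and its digits -/

lemma leftEnd_add_one {β : ℝ} (hβ : 1 < β) : leftEnd β + 1 = 1 / (β + 1) := by
  unfold leftEnd
  field_simp
  ring

lemma mem_I_iff {β x : ℝ} (hβ : 1 < β) : x ∈ I β ↔ leftEnd β ≤ x ∧ x < leftEnd β + 1 := by
  rw [leftEnd_add_one hβ]
  exact Iff.rfl

lemma mul_leftEnd {β : ℝ} (hβ : 1 < β) : β * leftEnd β = -β - leftEnd β := by
  unfold leftEnd
  field_simp
  ring

lemma leftEnd_lt {β : ℝ} (hβ : 1 < β) : leftEnd β < -1 / 2 := by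
  nlinarith [mul_leftEnd hβ]

lemma neg_one_lt_leftEnd {β : ℝ} (hβ : 1 < β) : -1 < leftEnd β := by
  nlinarith [mul_leftEnd hβ]

lemma floor_arg {β x : ℝ} : -β * x + β / (β + 1) = -β * x - leftEnd β := by
  unfold leftEnd
  ring

lemma T_mem {β : ℝ} (hβ : 1 < β) (x : ℝ) : T β x ∈ I β := by
  rw [mem_I_iff hβ, T, floor_arg]
  constructor
  · linarith [Int.floor_le (-β * x - leftEnd β)]
  · linarith [Int.lt_floor_add_one (-β * x - leftEnd β)]

lemma iterate_mem {β x : ℝ} (hβ : 1 < β) (hx : x ∈ I β) (k : ℕ) : (T β)^[k] x ∈ I β := by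
  cases k with
  | zero => exact hx
  | succ k => rw [Function.iterate_succ_apply']; exact T_mem hβ _

/-- The value of `T` is characterised by lying in the interval `I` of length one. -/
lemma T_eq_of_mem {β x : ℝ} (hβ : 1 < β) (a : ℤ) (h : -β * x - a ∈ I β) : T β x = -β * x - a := by
  rw [mem_I_iff hβ] at h
  have : ⌊-β * x + β / (β + 1)⌋ = a := by
    rw [floor_arg, Int.floor_eq_iff]
    constructor <;> linarith [h.1, h.2]
  rw [T, this]

lemma iterate_succ_digits (β x : ℝ) (i : ℕ) :
    (T β)^[i + 1] x = -β * (T β)^[i] x - digits β x i := by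
  rw [Function.iterate_succ_apply']
  rfl

lemma digits_iterate (β x : ℝ) (k i : ℕ) : digits β ((T β)^[k] x) i = digits β x (i + k) := by
  rw [digits, digits, Function.iterate_add_apply]

lemma digits_nonneg {β x : ℝ} (hβ : 1 < β) (hx : x ∈ I β) (i : ℕ) : 0 ≤ digits β x i := by
  have h := ((mem_I_iff hβ).1 (iterate_mem hβ hx i)).2
  rw [digits, floor_arg]
  apply Int.floor_nonneg.2
  nlinarith [mul_leftEnd hβ]

lemma digits_le {β x : ℝ} (hβ : 1 < β) (hx : x ∈ I β) (i : ℕ) : digits β x i ≤ ⌊β⌋ := by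
  have h := ((mem_I_iff hβ).1 (iterate_mem hβ hx i)).1
  rw [digits, floor_arg]
  apply Int.floor_le_floor
  nlinarith [mul_leftEnd hβ]

lemma abs_digits_le {β x : ℝ} (hβ : 1 < β) (hx : x ∈ I β) (i : ℕ) : |(digits β x i : ℝ)| ≤ β := by
  have h0 : (0 : ℝ) ≤ digits β x i := by exact_mod_cast digits_nonneg hβ hx i
  rw [abs_of_nonneg h0]
  exact (Int.cast_le.2 (digits_le hβ hx i)).trans (Int.floor_le β)

lemma zero_mem_I {β : ℝ} (hβ : 1 < β) : (0 : ℝ) ∈ I β := by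
  rw [mem_I_iff hβ]
  constructor <;> linarith [leftEnd_lt hβ, neg_one_lt_leftEnd hβ]

lemma leftEnd_mem_I {β : ℝ} (hβ : 1 < β) : leftEnd β ∈ I β := by
  rw [mem_I_iff hβ]
  constructor <;> linarith

lemma T_zero {β : ℝ} (hβ : 1 < β) : T β 0 = 0 := by
  have := T_eq_of_mem (x := 0) hβ 0 (by simpa using zero_mem_I hβ)
  simpa using this

lemma iterate_zero {β : ℝ} (hβ : 1 < β) (k : ℕ) : (T β)^[k] 0 = 0 :=
  Function.iterate_fixed (T_zero hβ) k

lemma iterate_eq_zero_of_le {β x : ℝ} (hβ : 1 < β) {j k : ℕ} (hjk : j ≤ k)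
    (h : (T β)^[j] x = 0) : (T β)^[k] x = 0 := by
  obtain ⟨i, rfl⟩ := Nat.exists_eq_add_of_le' hjk
  rw [Function.iterate_add_apply, h, iterate_zero hβ]

lemma digits_zero {β : ℝ} (hβ : 1 < β) (i : ℕ) : digits β 0 i = 0 := by
  have h := iterate_succ_digits β 0 i
  rw [iterate_zero hβ, iterate_zero hβ] at h
  have : (digits β 0 i : ℝ) = 0 := by linarith
  exact_mod_cast this

lemma abs_sub_lt_one_of_mem {β x y : ℝ} (hβ : 1 < β) (hx : x ∈ I β) (hy : y ∈ I β) :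
    |x - y| < 1 := by
  rw [mem_I_iff hβ] at hx hy
  rw [abs_lt]
  constructor <;> linarith [hx.1, hx.2, hy.1, hy.2]

/-- Points of `I` are determined by their digits: as long as the digits agree, `T` stretches the
distance of two points by the factor `β`. -/
lemma eq_of_digits_eq {β x y : ℝ} (hβ : 1 < β) (hx : x ∈ I β) (hy : y ∈ I β)
    (h : digits β x = digits β y) : x = y := by
  have key : ∀ k, (T β)^[k] x - (T β)^[k] y = (-β) ^ k * (x - y) := by
    intro k
    induction k with
    | zero => simp
    | succ k ih =>
      rw [iterate_succ_digits, iterate_succ_digits, h, pow_succ]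
      linear_combination (-β) * ih
  by_contra hne
  have hpos : 0 < |x - y| := abs_pos.2 (sub_ne_zero.2 hne)
  obtain ⟨k, hk⟩ := pow_unbounded_of_one_lt (1 / |x - y|) hβ
  have h1 := abs_sub_lt_one_of_mem hβ (iterate_mem hβ hx k) (iterate_mem hβ hy k)
  rw [key, abs_mul, abs_pow, abs_neg, abs_of_pos (by linarith : 0 < β)] at h1
  rw [div_lt_iff₀ hpos] at hk
  linarith

lemma endsInZeros_iff {β x : ℝ} (hβ : 1 < β) (hx : x ∈ I β) :
    EndsInZeros (digits β x) ↔ ∃ k, (T β)^[k] x = 0 := by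
  constructor
  · intro h
    obtain ⟨k, hk⟩ := eventually_atTop.1 h
    refine ⟨k, eq_of_digits_eq hβ (iterate_mem hβ hx k) (zero_mem_I hβ) ?_⟩
    funext i
    rw [digits_iterate, digits_zero hβ, hk _ (by omega)]
  · rintro ⟨k, hk⟩
    refine eventually_atTop.2 ⟨k, fun i hi => ?_⟩
    obtain ⟨j, rfl⟩ := Nat.exists_eq_add_of_le' hi
    rw [← digits_iterate, hk, digits_zero hβ]

/-! ### Finite expansions and orbits that reach zero -/

lemma eq_sum_digits {β : ℝ} (hβ : 1 < β) (x : ℝ) (k : ℕ) :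
    x = ∑ i ∈ Finset.range k, (digits β x i : ℝ) * (-β) ^ (-((i : ℤ) + 1))
      + (-β) ^ (-(k : ℤ)) * (T β)^[k] x := by
  have hb : -β ≠ 0 := by linarith
  induction k with
  | zero => simp
  | succ k ih =>
    rw [Finset.sum_range_succ, iterate_succ_digits]
    have : (-β) ^ (-(k : ℤ)) = (-β) ^ (-((k : ℤ) + 1)) * (-β) := by
      rw [← zpow_add_one₀ hb]; congr 1; ring
    rw [this] at ih
    push_cast
    linear_combination ih

/-- Division by `-β` prepends the digit `0`, except at the left end point. -/
lemma div_mem_I {β x : ℝ} (hβ : 1 < β) (hx : x ∈ I β) (hne : x ≠ leftEnd β) :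
    x / (-β) ∈ I β ∧ x / (-β) ≠ leftEnd β ∧ T β (x / (-β)) = x := by
  have hx' := (mem_I_iff hβ).1 hx
  have hlt : leftEnd β < x := lt_of_le_of_ne hx'.1 (Ne.symm hne)
  have hm := mul_leftEnd hβ
  have h1 : -β * (x / (-β)) = x := by
    have : -β ≠ 0 := by linarith
    field_simp
  have h2 : leftEnd β < x / (-β) := by
    by_contra! h
    nlinarith [leftEnd_lt hβ]
  have h3 : x / (-β) < leftEnd β + 1 := by
    by_contra! h
    nlinarith
  refine ⟨(mem_I_iff hβ).2 ⟨h2.le, h3⟩, h2.ne', ?_⟩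
  have := T_eq_of_mem (x := x / (-β)) hβ 0 (by simpa [h1] using hx)
  rw [this, h1]
  simp

lemma div_pow_mem_I {β x : ℝ} (hβ : 1 < β) (hx : x ∈ I β) (hne : x ≠ leftEnd β) (k : ℕ) :
    x / (-β) ^ k ∈ I β ∧ x / (-β) ^ k ≠ leftEnd β ∧ (T β)^[k] (x / (-β) ^ k) = x := by
  induction k with
  | zero => simpa using ⟨hx, hne⟩
  | succ k ih =>
    obtain ⟨h1, h2, h3⟩ := ih
    obtain ⟨g1, g2, g3⟩ := div_mem_I hβ h1 h2
    rw [pow_succ, ← div_div]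
    refine ⟨g1, g2, ?_⟩
    rw [Function.iterate_succ_apply, g3, h3]

lemma exists_of_mem_finiteExpansions {β z : ℝ} (hβ : 1 < β) (hz : z ∈ finiteExpansions β) :
    ∃ y ∈ I β, ∃ k : ℕ, ∃ j : ℤ, (T β)^[k] y = 0 ∧ z = (-β) ^ j * y := by
  have hb : -β ≠ 0 := by linarith
  rcases hz with rfl | ⟨n, s, ⟨-, ⟨y, hy, hs⟩, hsum⟩, hend⟩
  · exact ⟨0, zero_mem_I hβ, 0, 0, by simp, by simp⟩
  · have hyend : EndsInZeros (digits β y) := by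
      rw [hs]
      obtain ⟨M, hM⟩ := eventually_atTop.1 hend
      refine eventually_atTop.2 ⟨M + 1, fun i hi => ?_⟩
      obtain ⟨i, rfl⟩ : ∃ j, i = j + 1 := ⟨i - 1, by omega⟩
      exact hM i (by omega)
    obtain ⟨M, hM⟩ := (endsInZeros_iff hβ hy).1 hyend
    obtain ⟨M', hM'⟩ := eventually_atTop.1 hend
    have h1 : z = ∑ i ∈ Finset.range (M + M'), (s i : ℝ) * (-β) ^ (n - (i : ℤ)) := by
      refine hsum.unique (hasSum_sum_of_ne_finset_zero fun i hi => ?_)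
      rw [hM' i (by simp at hi; omega)]
      simp
    have h2 := eq_sum_digits hβ y (M + M' + 1)
    rw [iterate_eq_zero_of_le hβ (by omega) hM, hs, Finset.sum_range_succ'] at h2
    refine ⟨y, hy, M, n + 2, hM, ?_⟩
    rw [h1]
    conv_rhs => rw [h2]
    simp only [consZero, Int.cast_zero, zero_mul, add_zero, mul_zero, Finset.mul_sum]
    refine Finset.sum_congr rfl fun i _ => ?_
    rw [mul_left_comm, ← zpow_add₀ hb]
    congr 2
    push_cast
    ring

/-- A number of `I` with a finite expansion is carried to `0` by an iterate of `T`, if `leftEnd β` is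
not.
The exceptional point `leftEnd β` matters because its quotient by `-β` is the excluded right end
point of `I`. -/
lemma exists_iterate_eq_zero {β z : ℝ} (hβ : 1 < β)
    (hinf : ¬ EndsInZeros (digits β (leftEnd β))) (hz : z ∈ finiteExpansions β) (hzI : z ∈ I β) :
    ∃ k, (T β)^[k] z = 0 := by
  have hb : -β ≠ 0 := by linarith
  rw [endsInZeros_iff hβ (leftEnd_mem_I hβ)] at hinf
  obtain ⟨y, hy, k, j, hk, rfl⟩ := exists_of_mem_finiteExpansions hβ hz
  obtain ⟨J, rfl | rfl⟩ := Int.eq_nat_or_neg j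
  · rw [zpow_natCast] at hzI ⊢
    have hyz : (-β) ^ J * y / (-β) ^ J = y := by field_simp
    generalize (-β) ^ J * y = z at *
    by_cases hl : z = leftEnd β
    · subst hl
      exfalso
      have hm := mul_leftEnd hβ
      rcases J with _ | _ | J
      · simp only [pow_zero, div_one] at hyz
        subst hyz
        exact hinf ⟨k, hk⟩
      · have : leftEnd β / (-β) ^ 1 = leftEnd β + 1 := by
          field_simp
          linarith
        simp only [zero_add] at hyz
        rw [this] at hyz
        rw [mem_I_iff hβ] at hy
        linarith [hy.2]
      · -- The point `x₀` is mapped to the left end point with digit `1`.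
        set x₀ := (leftEnd β + 1) / (-β) with hx₀
        have e : -β * x₀ = leftEnd β + 1 := by rw [hx₀]; field_simp
        have hx₀I : x₀ ∈ I β := by
          rw [mem_I_iff hβ]
          constructor <;> by_contra! h <;> nlinarith [leftEnd_lt hβ, neg_one_lt_leftEnd hβ]
        have hx₀l : x₀ ≠ leftEnd β := by
          intro h
          rw [h] at e
          linarith
        have hT : T β x₀ = leftEnd β := by
          have := T_eq_of_mem (x := x₀) hβ 1 (by
            rw [e]; simpa using leftEnd_mem_I hβ)
          rw [this, e]
          simp
        obtain ⟨-, -, h⟩ := div_pow_mem_I hβ hx₀I hx₀l J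
        have hy' : x₀ / (-β) ^ J = y := by
          rw [← hyz, hx₀]
          field_simp
          linear_combination (-(-β) ^ J * β) * hm
        refine hinf ⟨k, ?_⟩
        rw [← hT, ← h, hy', ← Function.iterate_succ_apply' (T β), ← Function.iterate_add_apply,
          add_comm, Function.iterate_add_apply, hk, iterate_zero hβ]
    · obtain ⟨-, -, h⟩ := div_pow_mem_I hβ hzI hl J
      rw [hyz] at h
      refine ⟨k, ?_⟩
      rw [← h, ← Function.iterate_add_apply, add_comm, Function.iterate_add_apply, hk,
        iterate_zero hβ]
  · have hl : y ≠ leftEnd β := by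
      rintro rfl
      exact hinf ⟨k, hk⟩
    obtain ⟨-, -, h⟩ := div_pow_mem_I hβ hy hl J
    refine ⟨k + J, ?_⟩
    rw [zpow_neg, zpow_natCast, inv_mul_eq_div, Function.iterate_add_apply, h, hk]

lemma div_mem_finiteExpansions {β z : ℝ} (hβ : 1 < β) (hz : z ∈ finiteExpansions β) :
    z / (-β) ∈ finiteExpansions β := by
  have hb : -β ≠ 0 := by linarith
  rcases hz with rfl | ⟨n, s, ⟨h0, hadm, hsum⟩, hend⟩
  · left; simp
  · refine Or.inr ⟨n - 1, s, ⟨h0, hadm, ?_⟩, hend⟩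
    have heq : (fun i : ℕ => (s i : ℝ) * (-β) ^ (n - 1 - (i : ℤ)))
        = fun i : ℕ => (s i : ℝ) * (-β) ^ (n - (i : ℤ)) / (-β) := by
      funext i
      rw [sub_right_comm, zpow_sub_one₀ hb, div_eq_mul_inv, mul_assoc]
    rw [heq]
    exact hsum.div_const (-β)

/-! ### The digit recursion in an arbitrary ring -/

/-- The sequence `s₀ = v`, `s_{k+1} = -x s_k - d_k`. For `x = β` and `d` the digits of `v` this is
the `T`-orbit of `v`; ring homomorphisms transport it to the conjugates of `β`. -/
def shiftIter {R : Type*} [CommRing R] (x v : R) (d : ℕ → ℤ) : ℕ → R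
  | 0 => v
  | k + 1 => -x * shiftIter x v d k - d k

lemma iterate_eq_shiftIter (β y : ℝ) (k : ℕ) :
    (T β)^[k] y = shiftIter β y (digits β y) k := by
  induction k with
  | zero => rfl
  | succ k ih => rw [iterate_succ_digits, ih, shiftIter]

lemma map_shiftIter {R S : Type*} [CommRing R] [CommRing S] (f : R →+* S) (x v : R) (d : ℕ → ℤ)
    (k : ℕ) : f (shiftIter x v d k) = shiftIter (f x) (f v) d k := by
  induction k with
  | zero => rfl
  | succ k ih => simp [shiftIter, ih]

lemma shiftIter_eq_add {R : Type*} [CommRing R] (x v : R) (d : ℕ → ℤ) (k : ℕ) :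
    shiftIter x v d k = (-x) ^ k * v + shiftIter x 0 d k := by
  induction k with
  | zero => simp [shiftIter]
  | succ k ih =>
    rw [shiftIter, shiftIter, ih, pow_succ]
    ring

lemma norm_shiftIter_zero_le {x : ℂ} {d : ℕ → ℤ} {D ρ : ℝ} (hx : ‖x‖ ≤ ρ) (hρ : ρ < 1)
    (hd : ∀ i, |(d i : ℝ)| ≤ D) (k : ℕ) : ‖shiftIter x 0 d k‖ ≤ D / (1 - ρ) := by
  have hD : 0 ≤ D := (abs_nonneg _).trans (hd 0)
  have h1 : 0 < 1 - ρ := by linarith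
  induction k with
  | zero => simp only [shiftIter, norm_zero]; positivity
  | succ k ih =>
    rw [shiftIter]
    refine (norm_sub_le _ _).trans ?_
    rw [norm_mul, norm_neg, Complex.norm_intCast]
    have h2 : ‖x‖ * ‖shiftIter x 0 d k‖ ≤ ρ * (D / (1 - ρ)) :=
      mul_le_mul hx ih (norm_nonneg _) ((norm_nonneg _).trans hx)
    have h3 : ρ * (D / (1 - ρ)) + D = D / (1 - ρ) := by field_simp; ring
    linarith [hd k]

lemma norm_shiftIter_zero_le_mul {x : ℂ} {d : ℕ → ℤ} {D : ℝ} (hx : ‖x‖ = 1)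
    (hd : ∀ i, |(d i : ℝ)| ≤ D) (k : ℕ) : ‖shiftIter x 0 d k‖ ≤ k * D := by
  induction k with
  | zero => simp [shiftIter]
  | succ k ih =>
    rw [shiftIter]
    refine (norm_sub_le _ _).trans ?_
    rw [norm_mul, norm_neg, Complex.norm_intCast, hx]
    push_cast
    linarith [hd k]

lemma norm_le_of_shiftIter_eq_zero {x v : ℂ} {d : ℕ → ℤ} {D : ℝ} (hx : 1 < ‖x‖)
    (hd : ∀ i, |(d i : ℝ)| ≤ D) {k : ℕ} (h : shiftIter x v d k = 0) : ‖v‖ ≤ D / (‖x‖ - 1) := by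
  have hD : 0 ≤ D := (abs_nonneg _).trans (hd 0)
  have h1 : 0 < ‖x‖ - 1 := by linarith
  have key : ∀ k, ‖x‖ ^ k * (‖v‖ - D / (‖x‖ - 1)) ≤ ‖shiftIter x v d k‖ - D / (‖x‖ - 1) := by
    intro k
    induction k with
    | zero => simp [shiftIter]
    | succ k ih =>
      have h2 := norm_sub_norm_le (-x * shiftIter x v d k) (d k)
      rw [norm_mul, norm_neg, Complex.norm_intCast] at h2
      rw [shiftIter, pow_succ]
      have h3 : ‖x‖ * (D / (‖x‖ - 1)) = D + D / (‖x‖ - 1) := by field_simp; ring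
      have h4 := mul_le_mul_of_nonneg_left ih (norm_nonneg x)
      nlinarith [hd k]
  by_contra! hlt
  have h2 := key k
  rw [h, norm_zero] at h2
  have h3 : 0 < ‖x‖ ^ k * (‖v‖ - D / (‖x‖ - 1)) := mul_pos (by positivity) (by linarith)
  have h4 : 0 ≤ D / (‖x‖ - 1) := by positivity
  linarith

/-! ### Digit strings read backwards in base `-1/β` -/

lemma last_digit_pos {β y : ℝ} (hβ : 1 < β) (hy : y ∈ I β) {k : ℕ}
    (h0 : (T β)^[k + 1] y = 0) (h1 : (T β)^[k] y ≠ 0) : 1 ≤ digits β y k := by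
  have h2 := digits_nonneg hβ hy k
  rcases h2.lt_or_eq with h | h
  · exact h
  · rw [iterate_succ_digits, ← h] at h0
    simp only [Int.cast_zero, sub_zero, mul_eq_zero, neg_eq_zero] at h0
    rcases h0 with h0 | h0
    · linarith
    · exact absurd h0 h1

/-- The numbers `-shiftIter β⁻¹ 0 d k` are the backward sums `d_{k-1} - d_{k-2}/β + d_{k-3}/β² - ⋯`. -/
lemma neg_shiftIter_inv_succ (β : ℝ) (d : ℕ → ℤ) (k : ℕ) :
    -shiftIter β⁻¹ 0 d (k + 1) = d k - (-shiftIter β⁻¹ 0 d k) / β := by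
  rw [shiftIter]
  ring

/-- If `⌊β⌋ β < β² - 1`, a digit `1` outweighs any backward sum of digits in `{0, …, ⌊β⌋}` that is
divided by `-β`: these sums lie in `[-A, A β]` with `A = ⌊β⌋ β / (β² - 1) < 1`. -/
lemma exists_le_neg_shiftIter_of_mul_lt {β : ℝ} (hβ : 1 < β) (hm : ⌊β⌋ * β < β ^ 2 - 1) :
    ∃ c > 0, ∀ y ∈ I β, ∀ k, (T β)^[k + 1] y = 0 → (T β)^[k] y ≠ 0 →
      c ≤ -shiftIter β⁻¹ 0 (digits β y) (k + 1) := by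
  have hb : 0 < β := by linarith
  have hs : 0 < β ^ 2 - 1 := by nlinarith
  obtain ⟨A, hA⟩ : ∃ A : ℝ, A = ⌊β⌋ * β / (β ^ 2 - 1) := ⟨_, rfl⟩
  have hAe : A * (β ^ 2 - 1) = ⌊β⌋ * β := by rw [hA]; field_simp
  have hm0 : (0 : ℝ) ≤ ⌊β⌋ := by exact_mod_cast Int.floor_nonneg.2 hb.le
  have hA0 : 0 ≤ A := by rw [hA]; positivity
  have hA1 : A < 1 := by rw [hA, div_lt_one hs]; exact hm
  have hAβ : ⌊β⌋ + A / β = A * β := by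
    field_simp
    linarith
  refine ⟨1 - A, by linarith, fun y hy k h0 h1 => ?_⟩
  have hd0 : ∀ i, (0 : ℝ) ≤ digits β y i := fun i => by exact_mod_cast digits_nonneg hβ hy i
  have hd1 : ∀ i, (digits β y i : ℝ) ≤ ⌊β⌋ := fun i => by exact_mod_cast digits_le hβ hy i
  have inv : ∀ i, -A ≤ -shiftIter β⁻¹ 0 (digits β y) i ∧
      -shiftIter β⁻¹ 0 (digits β y) i ≤ A * β := by
    intro i
    induction i with
    | zero => simp only [shiftIter, neg_zero]; constructor <;> nlinarith
    | succ i ih =>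
      rw [neg_shiftIter_inv_succ]
      have u1 := div_le_div_of_nonneg_right ih.1 hb.le
      have u2 := div_le_div_of_nonneg_right ih.2 hb.le
      rw [mul_div_cancel_right₀ _ hb.ne'] at u2
      rw [neg_div] at u1
      constructor <;> linarith [hd0 i, hd1 i]
  have hk : (1 : ℝ) ≤ digits β y k := by exact_mod_cast last_digit_pos hβ hy h0 h1
  rw [neg_shiftIter_inv_succ]
  have u2 := div_le_div_of_nonneg_right (inv k).2 hb.le
  rw [mul_div_cancel_right₀ _ hb.ne'] at u2
  linarith

/-- In the complementary range a maximal digit is followed by one that is at least `⌊β⌋ - 1`, which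
again keeps the backward sums away from `0`. The tightest case is a string ending in the block `2 1`
with `⌊β⌋ = 2`: it occurs only if the cubic is nonnegative, and then the sum is at least a positive
multiple of the cubic. -/
lemma exists_le_neg_shiftIter_of_lt_mul {β : ℝ} (hβ : 1 < β) (hm : β ^ 2 < ⌊β⌋ * β + 1)
    (hm2 : 2 ≤ ⌊β⌋) (hg : β ^ 3 - 2 * β ^ 2 - β + 1 ≠ 0) :
    ∃ c > 0, ∀ y ∈ I β, ∀ k, (T β)^[k + 1] y = 0 → (T β)^[k] y ≠ 0 →
      c ≤ -shiftIter β⁻¹ 0 (digits β y) (k + 1) := by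
  have hb : 0 < β := by linarith
  have hs : 0 < β ^ 2 - 1 := by nlinarith
  have hmβ : (⌊β⌋ : ℝ) ≤ β := Int.floor_le β
  have hm2' : (2 : ℝ) ≤ ⌊β⌋ := by exact_mod_cast hm2
  obtain ⟨A, hA⟩ : ∃ A : ℝ, A = (⌊β⌋ - 1) * β / (β ^ 2 - 1) := ⟨_, rfl⟩
  have hAe : A * (β ^ 2 - 1) = (⌊β⌋ - 1) * β := by rw [hA]; field_simp
  have hA0 : 0 ≤ A := by
    rw [hA]
    exact div_nonneg (mul_nonneg (by linarith) hb.le) hs.le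
  have hA1 : A < 1 := by
    rw [hA, div_lt_one hs]
    nlinarith
  have hAβ : ⌊β⌋ - 1 + A / β = A * β := by
    field_simp
    linarith
  have hinv : β⁻¹ < 1 := inv_lt_one_of_one_lt₀ hβ
  have hml := mul_leftEnd hβ
  obtain ⟨c, hc0, hc1, hc2⟩ : ∃ c > 0, c ≤ 1 - A ∧ (0 < 1 - A - β⁻¹ → c ≤ 1 - A - β⁻¹) := by
    by_cases h : 0 < 1 - A - β⁻¹
    · exact ⟨_, h, by linarith [inv_pos.2 hb], fun _ => le_rfl⟩
    · exact ⟨1 - A, by linarith, le_rfl, fun h' => absurd h' h⟩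
  refine ⟨c, hc0, fun y hy k h0 h1 => ?_⟩
  have hd0 : ∀ i, (0 : ℝ) ≤ digits β y i := fun i => by exact_mod_cast digits_nonneg hβ hy i
  -- Points of `[leftEnd β, leftEnd β + (β - ⌊β⌋)]`, the range of `T` after a maximal digit.
  have next : ∀ i, (T β)^[i] y ≤ leftEnd β + (β - ⌊β⌋) → ⌊β⌋ - 1 ≤ digits β y i := by
    intro i hi
    rw [digits, floor_arg]
    apply Int.le_floor.2
    push_cast
    nlinarith
  have step : ∀ q : ℝ, q ≤ A * β → -A ≤ -q / β := by
    intro q hq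
    have := div_le_div_of_nonneg_right hq hb.le
    rw [mul_div_cancel_right₀ _ hb.ne'] at this
    rw [neg_div]
    linarith
  have step' : ∀ q : ℝ, q ≤ A * β + 1 → -A - β⁻¹ ≤ -q / β := by
    intro q hq
    have := step (q - 1) (by linarith)
    have e : -(q - 1) / β = -q / β + β⁻¹ := by field_simp; ring
    linarith
  have inv : ∀ i, -A ≤ -shiftIter β⁻¹ 0 (digits β y) i ∧
      (-shiftIter β⁻¹ 0 (digits β y) i ≤ A * β ∨
        (-shiftIter β⁻¹ 0 (digits β y) i ≤ A * β + 1 ∧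
          (T β)^[i] y ≤ leftEnd β + (β - ⌊β⌋))) := by
    intro i
    induction i with
    | zero =>
      simp only [shiftIter, neg_zero]
      exact ⟨by linarith, Or.inl (by positivity)⟩
    | succ i ih =>
      rw [neg_shiftIter_inv_succ]
      generalize -shiftIter β⁻¹ 0 (digits β y) i = q at ih ⊢
      rw [sub_eq_add_neg, ← neg_div]
      have u1 : -q / β ≤ A / β := div_le_div_of_nonneg_right (by linarith [ih.1]) hb.le
      refine ⟨?_, ?_⟩
      · rcases ih.2 with h | ⟨h, h'⟩
        · linarith [step q h, hd0 i]
        · have := step' q h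
          have h2 : ((⌊β⌋ - 1 : ℤ) : ℝ) ≤ digits β y i := by exact_mod_cast next i h'
          push_cast at h2
          linarith
      · rcases (digits_le hβ hy i).lt_or_eq with h | h
        · left
          have h2 : (digits β y i : ℝ) ≤ ((⌊β⌋ - 1 : ℤ) : ℝ) := by
            exact_mod_cast Int.le_sub_one_of_lt h
          push_cast at h2
          linarith
        · right
          rw [iterate_succ_digits, h]
          refine ⟨by linarith, ?_⟩
          have := ((mem_I_iff hβ).1 (iterate_mem hβ hy i)).1
          nlinarith
  have hk := last_digit_pos hβ hy h0 h1
  have hk' : (1 : ℝ) ≤ digits β y k := by exact_mod_cast hk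
  rw [neg_shiftIter_inv_succ]
  obtain ⟨-, h⟩ := inv k
  generalize -shiftIter β⁻¹ 0 (digits β y) k = q at h ⊢
  rw [sub_eq_add_neg, ← neg_div]
  rcases h with h | ⟨h, h'⟩
  · linarith [step q h]
  · have h3 := step' q h
    rcases hk.lt_or_eq with h2 | h2
    · have h2' : (2 : ℝ) ≤ digits β y k := by exact_mod_cast h2
      linarith
    · have hn := next k h'
      have hmeq : ⌊β⌋ = 2 := by omega
      rw [iterate_succ_digits, ← h2] at h0
      rw [hmeq] at h' hAe
      push_cast at h0 h' hAe
      have hg0 : 0 ≤ β ^ 3 - 2 * β ^ 2 - β + 1 := by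
        have e1 : β * (leftEnd β + (β - 2)) ≥ -1 := by nlinarith
        have e2 : leftEnd β * (β + 1) = -β := by linarith
        have e3 : 0 ≤ (β * (leftEnd β + (β - 2)) + 1) * (β + 1) :=
          mul_nonneg (by linarith) (by linarith)
        have e4 : (β * (leftEnd β + (β - 2)) + 1) * (β + 1) = β ^ 3 - 2 * β ^ 2 - β + 1 := by
          linear_combination β * e2
        linarith
      have hg1 := lt_of_le_of_ne hg0 (Ne.symm hg)
      have e5 : 1 - A - β⁻¹ = (β ^ 3 - 2 * β ^ 2 - β + 1) / (β * (β ^ 2 - 1)) := by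
        rw [eq_div_iff (by positivity)]
        field_simp
        linear_combination (-β) * hAe
      have e6 : 0 < 1 - A - β⁻¹ := by
        rw [e5]
        positivity
      linarith [hc2 e6]

/-! ### Algebraic properties of the base -/

lemma self_mem_adjoin (β : ℝ) : β ∈ Algebra.adjoin ℤ {β} :=
  Algebra.subset_adjoin rfl

lemma T_mem_adjoin {β x : ℝ} (hx : x ∈ Algebra.adjoin ℤ {β}) : T β x ∈ Algebra.adjoin ℤ {β} :=
  sub_mem (mul_mem (neg_mem (self_mem_adjoin β)) hx) (intCast_mem _ _)

lemma iterate_mem_adjoin {β x : ℝ} (hx : x ∈ Algebra.adjoin ℤ {β}) (k : ℕ) :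
    (T β)^[k] x ∈ Algebra.adjoin ℤ {β} := by
  induction k with
  | zero => exact hx
  | succ k ih => rw [Function.iterate_succ_apply']; exact T_mem_adjoin ih

/-- If the orbit of `1` reaches `0`, then the digits of `1` give a monic equation for `-β`. -/
lemma isIntegral_of_iterate_eq_zero {β : ℝ} {k : ℕ} (h : (T β)^[k] 1 = 0) : IsIntegral ℤ β := by
  have key : ∀ k, ∃ p : Polynomial ℤ, p.Monic ∧ p.natDegree = k ∧
      Polynomial.aeval (-β) p = (T β)^[k] 1 := by
    intro k
    induction k with
    | zero => exact ⟨1, Polynomial.monic_one, Polynomial.natDegree_one, by simp⟩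
    | succ k ih =>
      obtain ⟨p, hp, hd, he⟩ := ih
      have hdeg : (Polynomial.X * p).natDegree = k + 1 := by
        rw [Polynomial.natDegree_X_mul hp.ne_zero, hd]
      refine ⟨Polynomial.X * p - Polynomial.C (digits β 1 k), ?_, ?_, ?_⟩
      · refine (Polynomial.monic_X.mul hp).sub_of_left ?_
        refine Polynomial.degree_lt_degree ?_
        rw [hdeg, Polynomial.natDegree_C]
        omega
      · rw [Polynomial.natDegree_sub_C, hdeg]
      · rw [iterate_succ_digits, ← he]
        simp
  obtain ⟨p, hp, -, he⟩ := key k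
  have : IsIntegral ℤ (-β) := ⟨p, hp, by rw [← Polynomial.aeval_def, he, h]⟩
  simpa using this.neg

/-- For `β² < β + 1` the only preimage of `0` in `I` is `0`, so the orbit of `1 - β` avoids `0`. -/
lemma add_one_le_sq {β : ℝ} (hβ : 1 < β)
    (hF : ∀ z ∈ I β, z ∈ Algebra.adjoin ℤ {β} → ∃ k, (T β)^[k] z = 0) : β + 1 ≤ β ^ 2 := by
  by_contra! hlt
  have hl := mul_leftEnd hβ
  have hpre : ∀ y ∈ I β, T β y = 0 → y = 0 := by
    intro y hy h
    have h0 := digits_nonneg hβ hy 0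
    have h1 := digits_le hβ hy 0
    have e : T β y = -β * y - digits β y 0 := rfl
    have hm : ⌊β⌋ < 2 := Int.floor_lt.2 (by push_cast; nlinarith)
    rw [h] at e
    obtain hd | hd : digits β y 0 = 0 ∨ digits β y 0 = 1 := by omega
    · rw [hd] at e
      have : β * y = 0 := by push_cast at e; linarith
      rcases mul_eq_zero.1 this with h | h
      · linarith
      · exact h
    · rw [hd] at e
      push_cast at e
      have h2 := ((mem_I_iff hβ).1 hy).1
      nlinarith
  have hz : (1 - β) ∈ I β := by
    rw [mem_I_iff hβ]
    constructor
    · by_contra! h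
      nlinarith
    · linarith [neg_one_lt_leftEnd hβ, leftEnd_lt hβ]
  obtain ⟨k, hk⟩ := hF _ hz (sub_mem (one_mem _) (self_mem_adjoin β))
  have : ∀ k, (T β)^[k] (1 - β) ≠ 0 := by
    intro k
    induction k with
    | zero => simp only [Function.iterate_zero, id]; linarith
    | succ k ih =>
      rw [Function.iterate_succ_apply']
      exact fun h => ih (hpre _ (iterate_mem hβ hz k) h)
  exact this k hk

/-- Read backwards in base `-1/β`, a finite digit string is dominated by its last nonzero digit. The
two excluded equations are the borderline cases; neither is compatible with `β⁻¹` being a conjugate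
of `β`. -/
lemma exists_le_neg_shiftIter {β : ℝ} (hβ : 1 < β)
    (hF : ∀ z ∈ I β, z ∈ Algebra.adjoin ℤ {β} → ∃ k, (T β)^[k] z = 0)
    (h2 : β ^ 2 ≠ ⌊β⌋ * β + 1) (h3 : β ^ 3 - 2 * β ^ 2 - β + 1 ≠ 0) :
    ∃ c > 0, ∀ y ∈ I β, ∀ k, (T β)^[k + 1] y = 0 → (T β)^[k] y ≠ 0 →
      c ≤ -shiftIter β⁻¹ 0 (digits β y) (k + 1) := by
  rcases h2.lt_or_gt with h | h
  · refine exists_le_neg_shiftIter_of_lt_mul hβ h ?_ h3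
    by_contra! hm
    have hm1 : (⌊β⌋ : ℝ) ≤ 1 := by exact_mod_cast Int.le_of_lt_add_one hm
    nlinarith [add_one_le_sq hβ hF]
  · exact exists_le_neg_shiftIter_of_mul_lt hβ (by linarith)

lemma exists_iterate_succ_eq_zero {β f : ℝ} (h0 : f ≠ 0) (h : ∃ k, (T β)^[k] f = 0) :
    ∃ k, (T β)^[k + 1] f = 0 ∧ (T β)^[k] f ≠ 0 := by
  classical
  have hpos : Nat.find h ≠ 0 := fun h' => h0 (by simpa [h'] using Nat.find_spec h)
  obtain ⟨k, hk⟩ := Nat.exists_eq_succ_of_ne_zero hpos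
  have hs := Nat.find_spec h
  rw [hk] at hs
  exact ⟨k, hs, Nat.find_min h (by omega)⟩

lemma exists_linear_lt_pow {β c : ℝ} (hβ : 1 < β) (hc : 0 < c) (a : ℝ) :
    ∃ M : ℝ, ∀ k : ℕ, c * β ^ k ≤ a + k * β → k * β ≤ M := by
  have h1 : Tendsto (fun k : ℕ => (a + k * β) / β ^ k) atTop (nhds 0) := by
    have e1 := tendsto_pow_const_div_const_pow_of_one_lt 1 hβ
    have e2 := tendsto_pow_const_div_const_pow_of_one_lt 0 hβ
    have := (e2.const_mul a).add (e1.const_mul β)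
    simp only [mul_zero, add_zero] at this
    refine this.congr fun k => ?_
    rw [pow_one, pow_zero]
    ring
  obtain ⟨K, hK⟩ := eventually_atTop.1 (h1.eventually (gt_mem_nhds hc))
  refine ⟨K * β, fun k hk => ?_⟩
  by_contra! hlt
  have hKk : K ≤ k := by
    by_contra! h
    have : (k : ℝ) ≤ K := by exact_mod_cast h.le
    nlinarith
  have := hK k hKk
  rw [div_lt_iff₀ (by positivity)] at this
  linarith

/-- All conjugates of `β` other than `β` lie in the open unit disc, if the orbits of all points of
`I ∩ ℤ[β]` reach `0`. The points used are `f = (-β)^(L+1) - n`. -/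
theorem norm_conjugate_lt_one {K : Type*} [Field K] {β : ℝ} (hβ : 1 < β) (ι : K →+* ℝ) (b : K)
    (hb : ι b = β) (hF : ∀ z ∈ I β, z ∈ Algebra.adjoin ℤ {β} → ∃ k, (T β)^[k] z = 0)
    (φ : K →+* ℂ) (hφ : φ b ≠ β) : ‖φ b‖ < 1 := by
  have hb0 : 0 < β := by linarith
  set γ := φ b with hγ
  have key : ∀ L : ℕ, ∃ n : ℤ, ∃ f ∈ I β, f = (-β) ^ (L + 1) - n ∧ |f| ≤ 1 ∧
      (∃ k, (T β)^[k] f = 0) ∧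
      ∀ k, (T β)^[k] f = 0 → shiftIter b ((-b) ^ (L + 1) - n) (digits β f) k = 0 := by
    intro L
    have hf : T β ((-β) ^ L) ∈ I β := T_mem hβ _
    have hfe : T β ((-β) ^ L) = (-β) ^ (L + 1) - digits β ((-β) ^ L) 0 := by
      rw [pow_succ, mul_comm]; rfl
    refine ⟨digits β ((-β) ^ L) 0, _, hf, hfe, ?_,
      hF _ hf (T_mem_adjoin (pow_mem (neg_mem (self_mem_adjoin β)) L)), ?_⟩
    · simpa using (abs_sub_lt_one_of_mem hβ hf (zero_mem_I hβ)).le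
    · intro k hk
      apply ι.injective
      rw [map_shiftIter, map_zero, hb, ← hk, iterate_eq_shiftIter]
      congr 1
      rw [hfe]
      simp [hb]
  by_contra! hge
  rcases hge.lt_or_eq with hgt | heq
  · -- `γ^L - β^L` is bounded, which is impossible for `γ ≠ β`.
    have bound : ∀ L : ℕ, ‖γ ^ (L + 1) - (β : ℂ) ^ (L + 1)‖ ≤ 1 + β / (‖γ‖ - 1) := by
      intro L
      obtain ⟨n, f, hfI, hf, hf1, ⟨k, hk⟩, hs⟩ := key L
      have h1 := congrArg φ (hs k hk)
      rw [map_shiftIter, map_zero] at h1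
      have h2 := norm_le_of_shiftIter_eq_zero hgt (abs_digits_le hβ hfI) h1
      simp only [map_sub, map_pow, map_neg, map_intCast, ← hγ] at h2
      have h3 : ‖(f : ℂ)‖ ≤ 1 := by rwa [Complex.norm_real]
      have e : γ ^ (L + 1) - (β : ℂ) ^ (L + 1)
          = (-1) ^ (L + 1) * (((-γ) ^ (L + 1) - n) - f) := by
        rw [hf, neg_pow γ]
        push_cast
        rw [neg_pow (β : ℂ)]
        have : ((-1 : ℂ) ^ (L + 1)) * (-1) ^ (L + 1) = 1 := by
          rw [← mul_pow]; norm_num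
        linear_combination ((β : ℂ) ^ (L + 1) - γ ^ (L + 1)) * this
      rw [e, norm_mul, norm_pow, norm_neg, norm_one, one_pow, one_mul]
      linarith [norm_sub_le ((-γ) ^ (L + 1) - (n : ℂ)) f]
    set C := 1 + β / (‖γ‖ - 1)
    have hpos : 0 < ‖γ - β‖ := norm_pos_iff.2 (sub_ne_zero.2 hφ)
    obtain ⟨L, hL⟩ := pow_unbounded_of_one_lt ((C + β * C) / ‖γ - β‖) hgt
    rw [div_lt_iff₀ hpos] at hL
    have e : γ ^ (L + 1) * (γ - β) =
        (γ ^ (L + 1 + 1) - (β : ℂ) ^ (L + 1 + 1)) - β * (γ ^ (L + 1) - (β : ℂ) ^ (L + 1)) := by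
      ring
    have h1 : ‖γ ^ (L + 1) * (γ - β)‖ ≤ C + β * C := by
      rw [e]
      refine (norm_sub_le _ _).trans (add_le_add (bound _) ?_)
      rw [norm_mul, Complex.norm_real, Real.norm_of_nonneg hb0.le]
      exact mul_le_mul_of_nonneg_left (bound L) hb0.le
    rw [norm_mul, norm_pow] at h1
    have h2 : ‖γ‖ ^ L * ‖γ - β‖ ≤ ‖γ‖ ^ (L + 1) * ‖γ - β‖ :=
      mul_le_mul_of_nonneg_right (pow_le_pow_right₀ hge (Nat.le_succ L)) hpos.le
    linarith
  · -- Complex conjugation inverts `γ`, so `β⁻¹` is a conjugate of `β`.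
    have hconj : (starRingEnd ℂ) (φ b) = φ b⁻¹ := by
      rw [map_inv₀, ← hγ, Complex.inv_def, Complex.normSq_eq_norm_sq, ← heq]
      simp
    have hι : ι b⁻¹ = β⁻¹ := by rw [map_inv₀, hb]
    have h2 : β ^ 2 ≠ ⌊β⌋ * β + 1 := by
      intro h
      have e : b ^ 2 = (⌊β⌋ : K) * b + 1 := ι.injective (by simp [hb, h])
      have e' := congrArg (fun x => (starRingEnd ℂ) (φ x)) e
      simp only [map_pow, map_add, map_mul, map_intCast, map_one, hconj] at e'
      have e2 : b⁻¹ ^ 2 = (⌊β⌋ : K) * b⁻¹ + 1 := φ.injective (by simpa using e')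
      have e3 := congrArg ι e2
      simp only [map_pow, map_add, map_mul, map_intCast, map_one, hι] at e3
      field_simp at e3
      have hm : (1 : ℝ) ≤ ⌊β⌋ := by exact_mod_cast Int.le_floor.2 (by simpa using hβ.le)
      nlinarith
    have h3 : β ^ 3 - 2 * β ^ 2 - β + 1 ≠ 0 := by
      intro h
      have e : b ^ 3 - 2 * b ^ 2 - b + 1 = 0 := ι.injective (by simpa [hb, map_ofNat ι 2] using h)
      have e' := congrArg (fun x => (starRingEnd ℂ) (φ x)) e
      simp only [map_pow, map_add, map_sub, map_mul, map_ofNat, map_one, map_zero, hconj] at e'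
      have e2 : b⁻¹ ^ 3 - 2 * b⁻¹ ^ 2 - b⁻¹ + 1 = 0 :=
        φ.injective (by simpa [map_ofNat φ 2] using e')
      have e3 := congrArg ι e2
      simp only [map_pow, map_add, map_sub, map_mul, map_ofNat, map_one, map_zero, hι] at e3
      field_simp at e3
      nlinarith
    -- If `f` has exactly `k` digits, the conjugation to `β⁻¹` gives `c β^k ≤ |n| + 1`, and that to
    -- `γ` gives `|n| ≤ 1 + k β`. So `k` is bounded, in contradiction to `β^(L+1) - 1 ≤ |n|`.
    obtain ⟨c, hc, hlow⟩ := exists_le_neg_shiftIter hβ hF h2 h3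
    obtain ⟨M, hM⟩ := exists_linear_lt_pow hβ hc (3 + β)
    obtain ⟨L, hL⟩ := pow_unbounded_of_one_lt (2 + max M β) hβ
    obtain ⟨n, f, hfI, hf, hf1, hex, hs⟩ := key L
    have hLL : β ^ L ≤ β ^ (L + 1) := pow_le_pow_right₀ hβ.le (Nat.le_succ L)
    have habs : |(-β) ^ (L + 1)| = β ^ (L + 1) := by rw [abs_pow, abs_neg, abs_of_pos hb0]
    have hn1 : β ^ (L + 1) ≤ |(n : ℝ)| + 1 := by
      have := abs_add_le f n
      rw [show f + n = (-β) ^ (L + 1) by rw [hf]; ring, habs] at this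
      linarith
    have hn2 : |(n : ℝ)| ≤ β ^ (L + 1) + 1 := by
      have := abs_sub ((-β) ^ (L + 1)) f
      rw [show (-β) ^ (L + 1) - f = n by rw [hf]; ring, habs] at this
      linarith
    have hup : ∀ k, (T β)^[k] f = 0 → |(n : ℝ)| ≤ 1 + k * β := by
      intro k hk
      have h1 := congrArg φ (hs k hk)
      rw [map_shiftIter, map_zero, shiftIter_eq_add] at h1
      have h4 := norm_shiftIter_zero_le_mul heq.symm (abs_digits_le hβ hfI) k
      rw [← norm_neg, ← eq_neg_of_add_eq_zero_left h1, norm_mul, norm_pow, norm_neg, ← hγ, ← heq,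
        one_pow, one_mul] at h4
      simp only [map_sub, map_pow, map_neg, map_intCast, ← hγ] at h4
      have h5 := norm_sub_norm_le (n : ℂ) ((-γ) ^ (L + 1))
      rw [norm_pow, norm_neg, ← heq, one_pow, Complex.norm_intCast, norm_sub_rev] at h5
      linarith
    by_cases hf0 : f = 0
    · have := hup 0 (by simpa using hf0)
      simp only [Nat.cast_zero, zero_mul] at this
      linarith [le_max_right M β]
    · obtain ⟨k, hk1, hk0⟩ := exists_iterate_succ_eq_zero hf0 hex
      have h1 := hlow f hfI k hk1 hk0
      have h4 := congrArg (fun x => (starRingEnd ℂ) (φ x)) (hs _ hk1)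
      simp only [map_shiftIter, map_sub, map_pow, map_neg, map_intCast, map_zero, hconj] at h4
      have h5 : shiftIter b⁻¹ ((-b⁻¹) ^ (L + 1) - n) (digits β f) (k + 1) = 0 :=
        φ.injective (by simpa [map_shiftIter] using h4)
      have h6 := congrArg ι h5
      simp only [map_shiftIter, map_sub, map_pow, map_neg, map_intCast, map_zero, hι] at h6
      rw [shiftIter_eq_add] at h6
      rw [← eq_neg_iff_add_eq_zero.2 h6] at h1
      have h7 : (-β⁻¹) ^ (k + 1) * ((-β⁻¹) ^ (L + 1) - n) ≤ (β ^ (k + 1))⁻¹ * (1 + |(n : ℝ)|) := by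
        refine (le_abs_self _).trans ?_
        rw [abs_mul, abs_pow, abs_neg, abs_inv, abs_of_pos hb0, inv_pow]
        refine mul_le_mul_of_nonneg_left ?_ (by positivity)
        refine (abs_sub _ _).trans ?_
        rw [abs_pow, abs_neg, abs_inv, abs_of_pos hb0]
        have : β⁻¹ ^ (L + 1) ≤ 1 := pow_le_one₀ (by positivity) (inv_le_one_of_one_le₀ hβ.le)
        linarith
      have h8 : c * β ^ (k + 1) ≤ 1 + |(n : ℝ)| := by
        have := h1.trans h7
        rw [inv_mul_eq_div, le_div_iff₀ (by positivity)] at this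
        exact this
      have h9 := hup _ hk1
      have h10 := hM (k + 1) (by linarith)
      linarith [le_max_left M β]

/-! ### Distance of finite points to the orbit of the left end point -/

lemma exists_le_abs_iterate_leftEnd {β : ℝ} (hβ : 1 < β)
    (hper : EventuallyPeriodic (digits β (leftEnd β)))
    (hinf : ¬ EndsInZeros (digits β (leftEnd β))) :
    ∃ δ > 0, ∀ k, δ ≤ |(T β)^[k] (leftEnd β)| := by
  have hl := leftEnd_mem_I hβ
  rw [endsInZeros_iff hβ hl] at hinf
  push Not at hinf
  obtain ⟨p, hp, hev⟩ := hper
  obtain ⟨M, hM⟩ := eventually_atTop.1 hev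
  have hT : (T β)^[M + p] (leftEnd β) = (T β)^[M] (leftEnd β) := by
    refine eq_of_digits_eq hβ (iterate_mem hβ hl _) (iterate_mem hβ hl _) ?_
    funext i
    rw [digits_iterate, digits_iterate, ← hM (i + M) (by omega), add_assoc]
  have hred : ∀ k, ∃ k' < M + p, (T β)^[k] (leftEnd β) = (T β)^[k'] (leftEnd β) := by
    intro k
    induction k using Nat.strong_induction_on with
    | _ k ih =>
      by_cases h : k < M + p
      · exact ⟨k, h, rfl⟩
      · obtain ⟨k', hk', he⟩ := ih (k - p) (by omega)
        refine ⟨k', hk', ?_⟩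
        rw [← he]
        obtain ⟨j, rfl⟩ := Nat.exists_eq_add_of_le' (not_lt.1 h)
        rw [Function.iterate_add_apply, hT, ← Function.iterate_add_apply]
        congr 1
        omega
  obtain ⟨k₀, -, hk₀⟩ := Finset.exists_min_image (Finset.range (M + p))
    (fun k => |(T β)^[k] (leftEnd β)|) ⟨0, by simp; omega⟩
  refine ⟨_, abs_pos.2 (hinf k₀), fun k => ?_⟩
  obtain ⟨k', hk', he⟩ := hred k
  rw [he]
  exact hk₀ k' (by simpa using hk')

/-- A point whose orbit reaches `0` after `j` steps keeps a distance of order `β^(-j)` from the end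
points of `I`. The induction on `j` needs the whole orbit of the left end point: where two orbits
first have different digits, a discontinuity of `T` lies between them. -/
lemma exists_gap {β : ℝ} (hβ : 1 < β)
    (hper : EventuallyPeriodic (digits β (leftEnd β)))
    (hinf : ¬ EndsInZeros (digits β (leftEnd β))) :
    ∃ g > 0, g ≤ leftEnd β + 1 ∧ ∀ (j : ℕ), ∀ y ∈ I β, (T β)^[j] y = 0 →
      g ≤ β ^ j * (leftEnd β + 1 - y) ∧ ∀ k, g ≤ β ^ j * |y - (T β)^[k] (leftEnd β)| := by
  obtain ⟨δ, hδ, hmin⟩ := exists_le_abs_iterate_leftEnd hβ hper hinf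
  have hb0 : 0 < β := by linarith
  have hl1 := neg_one_lt_leftEnd hβ
  have hl2 := leftEnd_lt hβ
  have hml := mul_leftEnd hβ
  have hl := leftEnd_mem_I hβ
  refine ⟨min δ (leftEnd β + 1), lt_min hδ (by linarith), min_le_right _ _, fun j => ?_⟩
  have hg1 : min δ (leftEnd β + 1) ≤ 1 := (min_le_right _ _).trans (by linarith)
  induction j with
  | zero =>
    intro y _ h
    simp only [Function.iterate_zero, id] at h
    subst h
    simp only [pow_zero, one_mul, sub_zero, zero_sub, abs_neg]
    exact ⟨min_le_right _ _, fun k => (min_le_left _ _).trans (hmin k)⟩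
  | succ j ih =>
    intro y hy h
    rw [Function.iterate_succ_apply] at h
    have hTy := T_mem hβ y
    obtain ⟨ihr, ihk⟩ := ih _ hTy h
    have ih0 := ihk 0
    rw [Function.iterate_zero, id, abs_of_nonneg
      (by linarith [((mem_I_iff hβ).1 hTy).1])] at ih0
    have hpow : 1 ≤ β ^ j := one_le_pow₀ hβ.le
    have hpos : 0 < β ^ j := by positivity
    have e : T β y = -β * y - digits β y 0 := rfl
    refine ⟨?_, fun k => ?_⟩
    · rw [pow_succ, mul_assoc]
      rcases (digits_nonneg hβ hy 0).lt_or_eq with hd | hd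
      · have hd' : (1 : ℝ) ≤ digits β y 0 := by exact_mod_cast hd
        have h1 : 1 ≤ β * (leftEnd β + 1 - y) := by
          nlinarith [((mem_I_iff hβ).1 hTy).1]
        have : 1 ≤ β ^ j * (β * (leftEnd β + 1 - y)) := one_le_mul_of_one_le_of_one_le hpow h1
        linarith
      · rw [← hd] at e
        push_cast at e
        have : β * (leftEnd β + 1 - y) = T β y - leftEnd β := by rw [e]; linarith
        rw [this]
        exact ih0
    · rw [pow_succ, mul_assoc, ← abs_of_pos hb0, ← abs_mul, abs_of_pos hb0]
      set t := (T β)^[k] (leftEnd β)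
      have ht : (T β)^[k + 1] (leftEnd β) = -β * t - digits β (leftEnd β) k :=
        iterate_succ_digits β _ k
      have hTt := (mem_I_iff hβ).1 (iterate_mem hβ hl (k + 1))
      rcases lt_trichotomy (digits β y 0) (digits β (leftEnd β) k) with hd | hd | hd
      · have hd' : (digits β y 0 : ℝ) + 1 ≤ digits β (leftEnd β) k := by exact_mod_cast hd
        refine ihr.trans (mul_le_mul_of_nonneg_left ?_ hpos.le)
        refine le_trans ?_ (le_abs_self _)
        linarith [hTt.1]
      · rw [← hd] at ht
        have : β * (y - t) = -(T β y - (T β)^[k + 1] (leftEnd β)) := by rw [e, ht]; ring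
        rw [this, abs_neg]
        exact ihk (k + 1)
      · have hd' : (digits β (leftEnd β) k : ℝ) + 1 ≤ digits β y 0 := by exact_mod_cast hd
        refine ih0.trans (mul_le_mul_of_nonneg_left ?_ hpos.le)
        refine le_trans ?_ (neg_le_abs _)
        linarith [hTt.2]

/-- A finite digit block `d_{-β}(u)` of length `N` may be followed by the digits of any `x` that is
close enough to `0`. -/
lemma exists_iterate_add_eq {β : ℝ} (hβ : 1 < β)
    (hper : EventuallyPeriodic (digits β (leftEnd β)))
    (hinf : ¬ EndsInZeros (digits β (leftEnd β))) :
    ∃ g > 0, g ≤ leftEnd β + 1 ∧ ∀ x : ℝ, |x| < g → ∀ u ∈ I β, ∀ N : ℕ, (T β)^[N] u = 0 →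
      (T β)^[N] (u + x / (-β) ^ N) = x := by
  obtain ⟨g, hg, hgl, hgap⟩ := exists_gap hβ hper hinf
  have hb0 : 0 < β := by linarith
  have hb : -β ≠ 0 := by linarith
  refine ⟨g, hg, hgl, fun x hx u hu N => ?_⟩
  induction N generalizing u with
  | zero => intro h; simpa using h
  | succ N ih =>
    intro h
    rw [Function.iterate_succ_apply] at h ⊢
    have hTu := T_mem hβ u
    obtain ⟨h1, h2⟩ := hgap N _ hTu h
    have h3 := h2 0
    rw [Function.iterate_zero, id, abs_of_nonneg
      (by linarith [((mem_I_iff hβ).1 hTu).1])] at h3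
    have hpos : 0 < β ^ N := by positivity
    have h4 : |x / (-β) ^ N| * β ^ N = |x| := by
      rw [abs_div, abs_pow, abs_neg, abs_of_pos hb0]
      field_simp
    have h5 := abs_lt.1 (show |x / (-β) ^ N| < leftEnd β + 1 - T β u by
      refine lt_of_mul_lt_mul_right ?_ hpos.le
      linarith)
    have h6 := abs_lt.1 (show |x / (-β) ^ N| < T β u - leftEnd β by
      refine lt_of_mul_lt_mul_right ?_ hpos.le
      linarith)
    have e : -β * (u + x / (-β) ^ (N + 1)) - digits β u 0 = T β u + x / (-β) ^ N := by
      have e1 : T β u = -β * u - digits β u 0 := rfl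
      have e2 : -β * (x / (-β) ^ (N + 1)) = x / (-β) ^ N := by
        rw [pow_succ]
        field_simp
      rw [e1, mul_add, e2]
      ring
    have : T β (u + x / (-β) ^ (N + 1)) = T β u + x / (-β) ^ N := by
      rw [← e]
      refine T_eq_of_mem hβ _ ?_
      rw [e, mem_I_iff hβ]
      constructor <;> linarith [h5.2, h6.1]
    rw [this]
    exact ih _ hTu h

/-! ### Congruences and finiteness in `ℤ[β]` -/

lemma exists_pow_sub_one_eq_mul {β : ℝ} (hβ : 1 < β) (hint : IsIntegral ℤ β)
    (hinv : β⁻¹ ∈ Algebra.adjoin ℤ {β}) {q : ℕ} (hq : q ≠ 0) :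
    ∃ n > 0, ∀ j, ∃ w ∈ Algebra.adjoin ℤ {β}, (-β) ^ (n * j) - 1 = q * w := by
  let R := Algebra.adjoin ℤ {β}
  have : Module.Finite ℤ R := Module.Finite.iff_fg.2 hint.fg_adjoin_singleton
  let S := R ⧸ Ideal.span {(q : R)}
  have : Module.Finite ℤ S := Module.Finite.of_surjective
    (Ideal.Quotient.mk (Ideal.span {(q : R)})).toAddMonoidHom.toIntLinearMap
    Ideal.Quotient.mk_surjective
  have htors : Module.IsTorsion ℤ S := by
    intro s
    refine ⟨⟨(q : ℤ), mem_nonZeroDivisors_of_ne_zero (by exact_mod_cast hq)⟩, ?_⟩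
    obtain ⟨r, rfl⟩ := Ideal.Quotient.mk_surjective s
    change (q : ℤ) • Ideal.Quotient.mk (Ideal.span {(q : R)}) r = 0
    rw [zsmul_eq_mul, Int.cast_natCast, ← map_natCast (Ideal.Quotient.mk (Ideal.span {(q : R)})),
      ← map_mul, Ideal.Quotient.eq_zero_iff_mem]
    exact Ideal.mul_mem_right _ _ (Ideal.mem_span_singleton_self _)
  have : Finite S := Module.finite_of_fg_torsion S htors
  let b : R := ⟨β, self_mem_adjoin β⟩
  have hu : IsUnit (-b) := by
    refine IsUnit.neg (IsUnit.of_mul_eq_one ⟨β⁻¹, hinv⟩ ?_)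
    apply Subtype.ext
    exact mul_inv_cancel₀ (by linarith)
  obtain ⟨n, hn, hn1⟩ :=
    (hu.map (Ideal.Quotient.mk (Ideal.span {(q : R)}))).isOfFinOrder.exists_pow_eq_one
  refine ⟨n, hn, fun j => ?_⟩
  have h1 : Ideal.Quotient.mk (Ideal.span {(q : R)}) ((-b) ^ (n * j) - 1) = 0 := by
    rw [map_sub, map_pow, pow_mul, hn1, one_pow, map_one, sub_self]
  rw [Ideal.Quotient.eq_zero_iff_mem, Ideal.mem_span_singleton] at h1
  obtain ⟨w, hw⟩ := h1
  refine ⟨w, w.2, ?_⟩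
  have := congrArg (Subtype.val : R → ℝ) hw
  simpa using this

/-- Points of `I ∩ ℤ[β]` with bounded conjugates reach `0` after a bounded number of steps, because
there are only finitely many of them. -/
lemma exists_uniform_iterate_eq_zero {K : Type*} [Field K] [NumberField K] {β : ℝ} (hβ : 1 < β)
    (ι : K →+* ℝ) (hint : IsIntegral ℤ β)
    (hF : ∀ z ∈ I β, z ∈ Algebra.adjoin ℤ {β} → ∃ k, (T β)^[k] z = 0) (B : ℝ) :
    ∃ k, ∀ z : K, ι z ∈ I β → ι z ∈ Algebra.adjoin ℤ {β} → (∀ φ : K →+* ℂ, ‖φ z‖ ≤ B) →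
      (T β)^[k] (ι z) = 0 := by
  classical
  have hfin := NumberField.Embeddings.finite_of_norm_le K ℂ B
  have hex : ∀ z : K, ∃ k, ι z ∈ I β → ι z ∈ Algebra.adjoin ℤ {β} → (T β)^[k] (ι z) = 0 := by
    intro z
    by_cases h : ι z ∈ I β ∧ ι z ∈ Algebra.adjoin ℤ {β}
    · obtain ⟨k, hk⟩ := hF _ h.1 h.2
      exact ⟨k, fun _ _ => hk⟩
    · exact ⟨0, fun h1 h2 => absurd ⟨h1, h2⟩ h⟩
  choose f hf using hex
  refine ⟨hfin.toFinset.sup f, fun z hzI hz hB => ?_⟩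
  have hzint : IsIntegral ℤ (ι z) :=
    (adjoin_le_integralClosure hint : Algebra.adjoin ℤ {β} ≤ integralClosure ℤ ℝ) hz
  have hzint' : IsIntegral ℤ z := (isIntegral_algHom_iff ι.toIntAlgHom ι.injective).1 hzint
  exact iterate_eq_zero_of_le hβ
    (Finset.le_sup (f := f) (hfin.mem_toFinset.2 ⟨hzint', hB⟩)) (hf z hzI hz)

/-! ### Integers of the base and pure periodicity -/

/-- For small rational `x`, if `w = x ((-β)^N - 1)` lies in `ℤ[β]`, then it is a `(-β)`-integer: the
expansion of `w` has no fractional part. The number `k` comes from `exists_uniform_iterate_eq_zero`,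
and `ε` is chosen so that the conjugates of `w` stay bounded when they are divided by the `k`-th
powers of those of `-β`. -/
lemma exists_iterate_sub_div_eq_zero {β : ℝ} (hβ : 1 < β) (hint : IsIntegral ℤ β)
    (hF : ∀ z ∈ I β, z ∈ Algebra.adjoin ℤ {β} → ∃ k, (T β)^[k] z = 0) :
    ∃ ε > 0, ∃ k, ∀ N ≥ k, ∀ x : ℚ, |(x : ℝ)| < ε → (x : ℝ) - x / (-β) ^ N ∈ I β →
      (x : ℝ) - x / (-β) ^ N ∈ Algebra.adjoin ℤ {β} →
      (T β)^[N] ((x : ℝ) - x / (-β) ^ N) = 0 := by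
  classical
  have hb0 : 0 < β := by linarith
  let K := IntermediateField.adjoin ℚ {β}
  have hfd : FiniteDimensional ℚ K :=
    IntermediateField.adjoin.finiteDimensional hint.tower_top
  have hnf : NumberField K := ⟨⟩
  let ι : K →+* ℝ := algebraMap K ℝ
  let b : K := IntermediateField.AdjoinSimple.gen ℚ β
  have hb : ι b = β := IntermediateField.AdjoinSimple.algebraMap_gen ℚ β
  have hbne : b ≠ 0 := by
    intro h
    rw [h, map_zero] at hb
    linarith
  obtain ⟨ρ, hρ1, hρ⟩ : ∃ ρ < (1 : ℝ), ∀ φ : K →+* ℂ, φ b ≠ β → ‖φ b‖ ≤ ρ := by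
    obtain ⟨φ₀, hφ₀⟩ := Finite.exists_max
      (fun φ : K →+* ℂ => if φ b = β then (0 : ℝ) else ‖φ b‖)
    refine ⟨_, ?_, fun φ hφ => by simpa only [hφ, if_false] using hφ₀ φ⟩
    split_ifs with h
    · exact one_pos
    · exact norm_conjugate_lt_one hβ ι b hb hF φ₀ h
  obtain ⟨δ, hδ0, hδ⟩ : ∃ δ > (0 : ℝ), ∀ φ : K →+* ℂ, δ ≤ ‖φ b‖ := by
    obtain ⟨φ₀, hφ₀⟩ := Finite.exists_min (fun φ : K →+* ℂ => ‖φ b‖)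
    exact ⟨_, norm_pos_iff.2 ((map_ne_zero φ₀).2 hbne), hφ₀⟩
  obtain ⟨k, hk⟩ := exists_uniform_iterate_eq_zero hβ ι hint hF (1 + |β / (1 - ρ)|)
  refine ⟨δ ^ k / 2, by positivity, k, fun N hN x hx huI hu => ?_⟩
  obtain ⟨M, rfl⟩ := Nat.exists_eq_add_of_le hN
  set u := (x : ℝ) - x / (-β) ^ (k + M) with hudef
  have hd := abs_digits_le hβ huI
  let v : K := (x : K) - x / (-b) ^ (k + M)
  have hv : ι v = u := by simp [v, hudef, hb]
  let f : K := shiftIter b v (digits β u) M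
  have hf : ι f = (T β)^[M] u := by
    rw [map_shiftIter, hb, hv, iterate_eq_shiftIter]
  have hfI : (T β)^[M] u ∈ I β := iterate_mem hβ huI M
  rw [Function.iterate_add_apply, ← hf]
  refine hk f (hf ▸ hfI) (hf ▸ iterate_mem_adjoin hu M) fun φ => ?_
  by_cases hφ : φ b = β
  · have hφv : φ v = (u : ℂ) := by simp [v, hudef, hφ]
    have hφf : φ f = Complex.ofRealHom ((T β)^[M] u) := by
      rw [map_shiftIter, hφ, hφv, iterate_eq_shiftIter, map_shiftIter]
      rfl
    rw [hφf, Complex.ofRealHom_eq_coe, Complex.norm_real, Real.norm_eq_abs]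
    have := abs_sub_lt_one_of_mem hβ hfI (zero_mem_I hβ)
    rw [sub_zero] at this
    linarith [abs_nonneg (β / (1 - ρ))]
  · set γ := φ b with hγ
    have hγ0 : 0 < ‖γ‖ := hδ0.trans_le (hδ φ)
    have hγne : -γ ≠ 0 := neg_ne_zero.2 (norm_pos_iff.1 hγ0)
    have hγ1 : ‖γ‖ ≤ 1 := (hρ φ hφ).trans hρ1.le
    have hφv : (-γ) ^ M * φ v = x * ((-γ) ^ (k + M) - 1) / (-γ) ^ k := by
      simp only [v, map_sub, map_div₀, map_pow, map_neg, map_ratCast, ← hγ]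
      rw [pow_add]
      field_simp
    have h1 : ‖(-γ) ^ M * φ v‖ ≤ 1 := by
      have h2 : ‖(-γ) ^ (k + M) - 1‖ ≤ 2 := by
        refine (norm_sub_le _ _).trans ?_
        rw [norm_pow, norm_neg, norm_one]
        linarith [pow_le_one₀ (n := k + M) hγ0.le hγ1]
      have h3 : δ ^ k ≤ ‖γ‖ ^ k := pow_le_pow_left₀ hδ0.le (hδ φ) k
      have h4 : ‖(x : ℂ)‖ = |(x : ℝ)| := by
        rw [← Complex.ofReal_ratCast, Complex.norm_real, Real.norm_eq_abs]
      rw [hφv, norm_div, norm_mul, norm_pow, norm_neg, div_le_one (by positivity), h4]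
      have := mul_le_mul_of_nonneg_left h2 (abs_nonneg (x : ℝ))
      linarith
    rw [map_shiftIter, shiftIter_eq_add]
    refine (norm_add_le _ _).trans (add_le_add h1 ?_)
    exact (norm_shiftIter_zero_le (hρ φ hφ) hρ1 hd M).trans (le_abs_self _)

lemma purelyPeriodic_of_iterate_eq {β x : ℝ} {N : ℕ} (hN : 0 < N) (h : (T β)^[N] x = x) :
    PurelyPeriodic (digits β x) :=
  ⟨N, hN, fun i => by rw [← digits_iterate, h]⟩

end NegBase

theorem theorem14 (β : ℝ) (hβ : 1 < β)
    (hper : NegBase.EventuallyPeriodic (NegBase.digits β (NegBase.leftEnd β)))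
    (hinf : ¬ NegBase.EndsInZeros (NegBase.digits β (NegBase.leftEnd β)))
    (hfin : NegBase.finiteExpansions β = (Algebra.adjoin ℤ {β} : Set ℝ)) :
    ∃ γ : ℝ, 0 < γ ∧ ∀ x : ℚ, -γ < (x : ℝ) → (x : ℝ) < γ →
      (x : ℝ) ∈ NegBase.I β ∧ NegBase.PurelyPeriodic (NegBase.digits β (x : ℝ)) := by
  open NegBase in
  have hb0 : 0 < β := by linarith
  have hF : ∀ z ∈ I β, z ∈ Algebra.adjoin ℤ {β} → ∃ k, (T β)^[k] z = 0 := by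
    intro z hzI hz
    refine exists_iterate_eq_zero hβ hinf ?_ hzI
    rw [hfin]
    exact hz
  have hint : IsIntegral ℤ β := by
    obtain ⟨k, hk⟩ := hF _ (T_mem hβ 1) (T_mem_adjoin (one_mem _))
    exact isIntegral_of_iterate_eq_zero (k := k + 1) hk
  have hinv : β⁻¹ ∈ Algebra.adjoin ℤ {β} := by
    have h1 : (1 : ℝ) ∈ finiteExpansions β := by rw [hfin]; exact one_mem _
    have h2 := div_mem_finiteExpansions hβ h1
    rw [hfin] at h2
    have h3 : -(1 / (-β)) ∈ Algebra.adjoin ℤ {β} := neg_mem h2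
    rwa [one_div, inv_neg, neg_neg] at h3
  obtain ⟨ε, hε, k, hk⟩ := exists_iterate_sub_div_eq_zero hβ hint hF
  obtain ⟨g, hg, hgl, hadd⟩ := exists_iterate_add_eq hβ hper hinf
  have hl := leftEnd_lt hβ
  have hl' := neg_one_lt_leftEnd hβ
  refine ⟨min ε (g / 2), by positivity, fun x hx1 hx2 => ?_⟩
  have hx : |(x : ℝ)| < min ε (g / 2) := abs_lt.2 ⟨hx1, hx2⟩
  have hxε := hx.trans_le (min_le_left _ _)
  have hxg := hx.trans_le (min_le_right _ _)
  have hxI : (x : ℝ) ∈ I β := by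
    rw [mem_I_iff hβ]
    constructor <;> linarith [(abs_lt.1 hxg).1, (abs_lt.1 hxg).2]
  refine ⟨hxI, ?_⟩
  obtain ⟨n, hn, hdiv⟩ := exists_pow_sub_one_eq_mul hβ hint hinv x.den_nz
  have hN : k ≤ n * (k + 1) := by nlinarith
  have hN0 : 0 < n * (k + 1) := by positivity
  obtain ⟨w, hw, hwe⟩ := hdiv (k + 1)
  set N := n * (k + 1)
  have hpow : (-β) ^ N ≠ 0 := pow_ne_zero _ (by linarith)
  have huI : (x : ℝ) - x / (-β) ^ N ∈ I β := by
    have h1 : |(x : ℝ) / (-β) ^ N| ≤ |(x : ℝ)| := by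
      rw [abs_div, abs_pow, abs_neg, abs_of_pos hb0]
      exact div_le_self (abs_nonneg _) (one_le_pow₀ hβ.le)
    have h2 := abs_lt.1 ((h1.trans_lt hxg))
    have h3 := abs_lt.1 hxg
    rw [mem_I_iff hβ]
    constructor <;> linarith [h2.1, h2.2, h3.1, h3.2]
  have hu : (x : ℝ) - x / (-β) ^ N ∈ Algebra.adjoin ℤ {β} := by
    have hden : (x.den : ℝ) ≠ 0 := by exact_mod_cast x.den_nz
    have e : (x : ℝ) - x / (-β) ^ N = x.num * w * (-β⁻¹) ^ N := by
      have e1 : (-β⁻¹) ^ N = ((-β) ^ N)⁻¹ := by rw [← inv_neg, inv_pow]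
      have e2 : (x : ℝ) * x.den = x.num := by exact_mod_cast Rat.mul_den_eq_num x
      rw [e1, ← e2, mul_assoc _ _ w, ← hwe]
      field_simp
    rw [e]
    exact mul_mem (mul_mem (intCast_mem _ _) hw) (pow_mem (neg_mem hinv) N)
  have h0 := hk N hN x hxε huI hu
  refine purelyPeriodic_of_iterate_eq hN0 ?_
  have := hadd x (by linarith) _ huI N h0
  rwa [sub_add_cancel] at this
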